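/- All graphs are finite, simple and undirected. A graph with $n\ge 3$ vertices is \emph{optimal 1-planar} if it can be drawn in the plane with at most one crossing per edge and has $4n-8$ edges. For $k\ge 3$ the \emph{extended wheel graph} $XW_{2k}$ consists of a cycle of length $2k$, edges between the vertices at distance two on the cycle, and two nonadjacent poles, each joined to all vertices of the cycle. \emph{Reductions.} Let $G$ be a graph; a match is an injective map of vertices that preserves edges (further edges of $G$ between the matched vertices are allowed). $SR(x\mapsto x_4)$: $G$ has a vertex $x$ of degree six and distinct neighbours $x_1,\dots,x_6$ of $x$ such that $x_ix_{i+1}$ (indices modulo 6) and $x_1x_3,\ x_3x_5,\ x_5x_1$ are edges. It is feasible if none of $x_1x_4,\ x_2x_4,\ x_6x_4$ is an edge of $G$. It removes $x$ and the edge $x_3x_5$ and adds the edges $x_1x_4,\ x_2x_4,\ x_6x_4$. $CR(x_1,x_2,x_3,x_4)$: $G$ has distinct vertices $x_1,\dots,x_4,v_1,\dots,v_4$ such that every $x_i$ has degree six, the $x_i$ are pairwise adjacent, $x_i$ is adjacent to $v_{i-1},v_i,v_{i+1}$, and $v_iv_{i+1}$ is an edge (indices modulo 4). It is feasible if neither $v_1v_3$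 nor $v_2v_4$ is an edge of $G$. It removes $x_1,\dots,x_4$ and adds the edges $v_1v_3$ and $v_2v_4$. Write $G\to G'$ if $G'$ is isomorphic to the result of a feasible $SR$- or $CR$-reduction of $G$, and let $\to^*$ be the reflexive and transitive closure. For $m\ge 3$ let $N_m$ (the \emph{nested crossed quadrangles}) be the graph with vertices $u_{i,a}$, $0\le i<m$, $a\in\mathbb Z/4$, and edges $u_{i,a}u_{i,a+1}$ for all $i,a$; $u_{i,a}u_{i,a+2}$ for $i\in\{0,m-1\}$; and $u_{i,a}u_{i+1,b}$ for $0\le i<m-1$ and $b\in\{a-1,a,a+1\}$. \textbf{Theorem.} There are infinitely many optimal 1-planar graphs for which every reduction to an extended wheel graph ends at $XW_6$ and only $CR$-reductions can ever be applied. More precisely, the graphs $N_m$, $m\ge 3$, are pairwise non-isomorphic, and for every $m\ge 3$: (a) $N_m$ is optimal 1-planar; (b) $N_m\to^* XW_6$; (c) if $N_m\to^* XW_{2k}$ with $k\ge 3$, then $k=3$; (d) if $N_m\to^* H$, then $H$ is optimal 1-planar, no feasible $SR$-reduction exists for $H$, and either $H$ is isomorphic to $XW_6$ or there is a feasible $CR$-reduction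 of $H$. -/

import Mathlib

/-- The open arc of a curve parametrised by `[0, 1]`. -/
def openArc (γ : ℝ → ℝ × ℝ) : Set (ℝ × ℝ) := γ '' Set.Ioo 0 1

/-- A drawing of a simple graph in the plane in which every edge is crossed at most once.
Vertices are distinct points, every edge is a simple Jordan arc between its two endpoints that
contains no vertex in its interior, and a crossing of an edge `e` is a common interior point of
`e` and another edge. Only the values of `curve` at edges of `G` matter. -/
structure OnePlanarDrawing {V : Type} (G : SimpleGraph V) where
  pos : V → ℝ × ℝ
  curve : Sym2 V → ℝ → ℝ × ℝ
  pos_injective : Function.Injective pos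
  continuousOn : ∀ e ∈ G.edgeSet, ContinuousOn (curve e) (Set.Icc 0 1)
  injOn : ∀ e ∈ G.edgeSet, Set.InjOn (curve e) (Set.Icc 0 1)
  endpoints : ∀ e ∈ G.edgeSet, s(curve e 0, curve e 1) = e.map pos
  avoids_vertices : ∀ e ∈ G.edgeSet, ∀ v, pos v ∉ openArc (curve e)
  crossed_at_most_once : ∀ e ∈ G.edgeSet, ∀ f ∈ G.edgeSet, ∀ g ∈ G.edgeSet, f ≠ e → g ≠ e →
    ∀ p ∈ openArc (curve e) ∩ openArc (curve f), ∀ q ∈ openArc (curve e) ∩ openArc (curve g),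
      f = g ∧ p = q

/-- A graph is 1-planar if it has a drawing with at most one crossing per edge. -/
def IsOnePlanar {V : Type} (G : SimpleGraph V) : Prop := Nonempty (OnePlanarDrawing G)

/-- A finite 1-planar graph with `n ≥ 3` vertices is optimal if it has `4 n - 8` edges. -/
def IsOptimalOnePlanar {V : Type} (G : SimpleGraph V) : Prop :=
  Finite V ∧ 3 ≤ Nat.card V ∧ IsOnePlanar G ∧ G.edgeSet.ncard + 8 = 4 * Nat.card V

/-- The extended wheel graph `XW_{2k}` (for `k ≥ 3`): a cycle of length `2k`, edges between vertices
at distance two on the cycle, and two nonadjacent poles joined to all vertices of the cycle. -/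
def extendedWheel (k : ℕ) : SimpleGraph (ZMod (2 * k) ⊕ Bool) :=
  SimpleGraph.fromRel fun u w => match u, w with
    | .inl i, .inl j => j = i + 1 ∨ j = i + 2
    | .inl _, .inr _ => True
    | .inr _, _ => False

/-- The nested crossed quadrangles with `m` levels: every level is a 4-cycle, the space between
consecutive levels is divided into four kites (`b = a` gives the planar edges, `b = a + 1` and
`b = a - 1` the crossing ones), and the innermost and the outermost 4-cycle have both diagonals. -/
def nestedQuadrangles (m : ℕ) : SimpleGraph (Fin m × ZMod 4) :=
  SimpleGraph.fromRel fun u w => match u, w with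
    | (i, a), (j, b) =>
      (i = j ∧ b = a + 1) ∨
      (i = j ∧ (i.val = 0 ∨ i.val + 1 = m) ∧ b = a + 2) ∨
      (i.val + 1 = j.val ∧ (b = a ∨ b = a + 1 ∨ b = a - 1))

/-- The crossed star `CS`: the center `x` is `none`, its neighbours `x_1, …, x_6` are
`some 1, …, some 6` (indices modulo 6). It consists of the three kites with the planar
quadrilaterals `(x, x_1, x_2, x_3)`, `(x, x_3, x_4, x_5)`, `(x, x_5, x_6, x_1)`. -/
def crossedStar : SimpleGraph (Option (ZMod 6)) :=
  SimpleGraph.fromRel fun u w => match u, w with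
    | none, some _ => True
    | some i, some j => j = i + 1 ∨ (i = 1 ∧ j = 3) ∨ (i = 3 ∧ j = 5) ∨ (i = 5 ∧ j = 1)
    | _, none => False

/-- The crossed cube `CC` without diagonals in the outer face: the inner cycle `x_1, …, x_4` is
`Sum.inl`, the outer cycle `v_1, …, v_4` is `Sum.inr` (indices modulo 4). -/
def crossedCube : SimpleGraph (ZMod 4 ⊕ ZMod 4) :=
  SimpleGraph.fromRel fun u w => match u, w with
    | .inl i, .inl j => i ≠ j
    | .inl i, .inr j => j = i ∨ j = i + 1 ∨ j = i - 1
    | .inr i, .inr j => j = i + 1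
    | .inr _, .inl _ => False

/-- A candidate is a vertex of degree six. -/
def IsCandidate {V : Type} (G : SimpleGraph V) (x : V) : Prop := (G.neighborSet x).ncard = 6

/-- Feasibility of `SR(x ↦ x_4)` at a subgraph of `G` matched by the crossed star: the center is a
candidate and there is no blocking edge. The other two targets at `x` are covered by rotating the
match. -/
def SRFeasible {V : Type} {G : SimpleGraph V} (φ : SimpleGraph.Copy crossedStar G) : Prop :=
  IsCandidate G (φ none) ∧
    ¬ G.Adj (φ (some 2)) (φ (some 4)) ∧
    ¬ G.Adj (φ (some 6)) (φ (some 4)) ∧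
    ¬ G.Adj (φ (some 1)) (φ (some 4))

/-- The result of `SR(x ↦ x_4)`: `x` is removed and the crossed star is replaced by the two
adjacent kites with the planar quadrilaterals `(x_1, x_2, x_3, x_4)` and `(x_1, x_4, x_5, x_6)`. -/
def srResult {V : Type} {G : SimpleGraph V} (φ : SimpleGraph.Copy crossedStar G) :
    SimpleGraph {u : V | u ≠ φ none} :=
  (G.deleteEdges {s(φ (some 3), φ (some 5))} ⊔
    SimpleGraph.edge (φ (some 1)) (φ (some 4)) ⊔
    SimpleGraph.edge (φ (some 2)) (φ (some 4)) ⊔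
    SimpleGraph.edge (φ (some 6)) (φ (some 4))).induce {u : V | u ≠ φ none}

/-- Feasibility of `CR(x_1, x_2, x_3, x_4)` at a subgraph of `G` matched by the crossed cube: the
vertices of the inner cycle are candidates and there is no blocking edge. -/
def CRFeasible {V : Type} {G : SimpleGraph V} (φ : SimpleGraph.Copy crossedCube G) : Prop :=
  (∀ i : ZMod 4, IsCandidate G (φ (.inl i))) ∧
    ¬ G.Adj (φ (.inr 1)) (φ (.inr 3)) ∧
    ¬ G.Adj (φ (.inr 2)) (φ (.inr 4))

/-- The result of `CR(x_1, x_2, x_3, x_4)`: the inner cycle is removed and both diagonals of the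
outer cycle are added, so that the crossed cube is replaced by a kite. -/
def crResult {V : Type} {G : SimpleGraph V} (φ : SimpleGraph.Copy crossedCube G) :
    SimpleGraph {u : V | ∀ i : ZMod 4, u ≠ φ (.inl i)} :=
  (G ⊔ SimpleGraph.edge (φ (.inr 1)) (φ (.inr 3)) ⊔
    SimpleGraph.edge (φ (.inr 2)) (φ (.inr 4))).induce {u : V | ∀ i : ZMod 4, u ≠ φ (.inl i)}

/-- A simple graph together with its vertex type. -/
structure BundledGraph where
  V : Type
  graph : SimpleGraph V

/-- `A` reduces to `B` (up to isomorphism) by one feasible `SR`-reduction. -/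
def SRStep (A B : BundledGraph) : Prop :=
  ∃ φ : SimpleGraph.Copy crossedStar A.graph, SRFeasible φ ∧ Nonempty (srResult φ ≃g B.graph)

/-- `A` reduces to `B` (up to isomorphism) by one feasible `CR`-reduction. -/
def CRStep (A B : BundledGraph) : Prop :=
  ∃ φ : SimpleGraph.Copy crossedCube A.graph, CRFeasible φ ∧ Nonempty (crResult φ ≃g B.graph)

/-- The reflexive and transitive closure of the one-step reductions by `SR` or `CR`. -/
def Reduces : BundledGraph → BundledGraph → Prop :=
  Relation.ReflTransGen fun A B => SRStep A B ∨ CRStep A B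

/-!
Every graph reachable from `N_m` is some `N_k` with `2 ≤ k`, and `N_2` is `XW_6`.

The candidates of `N_m` are the vertices of the two end levels, and the neighbours of a candidate
lie on two consecutive levels. Two of them can only be nonadjacent if they lie in opposite columns.
A feasible `SR(x ↦ x_4)` would therefore put `x_1`, `x_2` and `x_6` into the column opposite to
`x_4`, which contains just two neighbours of `x`. The four pairwise adjacent candidates of a
feasible `CR`-reduction form an end level, and the added diagonals turn the next level into an end
level, so that the result is `N_{m-1}`. In `N_2` all eight vertices are candidates, and there a
feasible `CR`-reduction would force a vertex of degree seven.

For 1-planarity, `N_m` is drawn in logarithmic polar coordinates, where levels are vertical segments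
and columns are horizontal lines. The open edges lie in distinct cells of a subdivision of the
plane, except for the two crossing edges of a kite, which share a cell and meet once.
-/

section Isomorphism

variable {V W : Type} {G : SimpleGraph V} {H : SimpleGraph W}

lemma IsOnePlanar.of_copy (f : SimpleGraph.Copy H G) (h : IsOnePlanar G) : IsOnePlanar H := by
  obtain ⟨D⟩ := h
  have mem : ∀ x ∈ H.edgeSet, x.map f ∈ G.edgeSet := fun _ hx => f.toHom.map_mem_edgeSet hx
  have inj : Function.Injective (Sym2.map f) := Sym2.map.injective f.injective
  exact ⟨{
    pos := D.pos ∘ f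
    curve := D.curve ∘ Sym2.map f
    pos_injective := D.pos_injective.comp f.injective
    continuousOn := fun x hx => D.continuousOn _ (mem x hx)
    injOn := fun x hx => D.injOn _ (mem x hx)
    endpoints := fun x hx => by
      rw [Function.comp_apply, D.endpoints _ (mem x hx), Sym2.map_map]
    avoids_vertices := fun x hx v => D.avoids_vertices _ (mem x hx) (f v)
    crossed_at_most_once := fun x hx y hy z hz hyx hzx p hp q hq =>
      (D.crossed_at_most_once _ (mem x hx) _ (mem y hy) _ (mem z hz) (inj.ne hyx) (inj.ne hzx)
        p hp q hq).imp_left fun h => inj h }⟩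

lemma IsOptimalOnePlanar.of_iso (e : H ≃g G) (h : IsOptimalOnePlanar G) :
    IsOptimalOnePlanar H := by
  obtain ⟨hfin, hcard, hplanar, hedges⟩ := h
  have hV : Nat.card W = Nat.card V := Nat.card_congr e.toEquiv
  have hE : H.edgeSet.ncard = G.edgeSet.ncard := Nat.card_congr e.mapEdgeSet
  exact ⟨Finite.of_equiv V e.symm.toEquiv, hV ▸ hcard, hplanar.of_copy e.toCopy,
    by rw [hE, hV, hedges]⟩

lemma ncard_neighborSet_iso_apply (e : H ≃g G) (u : W) :
    (G.neighborSet (e u)).ncard = (H.neighborSet u).ncard :=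
  (Nat.card_congr (e.mapNeighborSet u)).symm

lemma isCandidate_iso_apply (e : H ≃g G) (u : W) : IsCandidate G (e u) ↔ IsCandidate H u := by
  rw [IsCandidate, IsCandidate, ncard_neighborSet_iso_apply]

lemma SRFeasible.iso_comp {φ : SimpleGraph.Copy crossedStar H} (hφ : SRFeasible φ) (e : H ≃g G) :
    SRFeasible (e.toCopy.comp φ) := by
  simpa [SRFeasible, isCandidate_iso_apply, e.map_adj_iff] using hφ

lemma CRFeasible.iso_comp {φ : SimpleGraph.Copy crossedCube H} (hφ : CRFeasible φ) (e : H ≃g G) :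
    CRFeasible (e.toCopy.comp φ) := by
  simpa [CRFeasible, isCandidate_iso_apply, e.map_adj_iff] using hφ

end Isomorphism

section CrossedCube

variable {V W : Type} {G : SimpleGraph V} {H : SimpleGraph W}

lemma zmod_four_ne_add_two (i : ZMod 4) : i ≠ i + 2 := by
  decide +revert

lemma crossedCube_adj_inl_inl {i j : ZMod 4} : crossedCube.Adj (.inl i) (.inl j) ↔ i ≠ j := by
  simp [crossedCube, eq_comm]

lemma crossedCube_adj_inl_inr {i j : ZMod 4} :
    crossedCube.Adj (.inl i) (.inr j) ↔ j ≠ i + 2 := by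
  simp only [crossedCube, SimpleGraph.fromRel_adj, ne_eq, reduceCtorEq, not_false_eq_true,
    or_false, true_and]
  decide +revert

lemma crossedCube_adj_inr_inr {i j : ZMod 4} :
    crossedCube.Adj (.inr i) (.inr j) ↔ j = i + 1 ∨ j = i - 1 := by
  simp only [crossedCube, SimpleGraph.fromRel_adj, ne_eq, Sum.inr.injEq]
  decide +revert

lemma CRFeasible.not_adj_inr_add_two {φ : SimpleGraph.Copy crossedCube G} (hφ : CRFeasible φ)
    (i : ZMod 4) : ¬ G.Adj (φ (.inr i)) (φ (.inr (i + 2))) := by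
  obtain ⟨-, h₁₃, h₂₄⟩ := hφ
  have cases : ∀ i : ZMod 4, (i = 1 ∧ i + 2 = 3) ∨ (i = 2 ∧ i + 2 = 4) ∨ (i = 3 ∧ i + 2 = 1) ∨
    (i = 4 ∧ i + 2 = 2) := by decide
  rcases cases i with ⟨h, h'⟩ | ⟨h, h'⟩ | ⟨h, h'⟩ | ⟨h, h'⟩ <;> rw [h', h]
  exacts [h₁₃, h₂₄, fun h => h₁₃ h.symm, fun h => h₂₄ h.symm]

lemma crResult_adj (φ : SimpleGraph.Copy crossedCube G)
    (u w : {u : V | ∀ i : ZMod 4, u ≠ φ (.inl i)}) :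
    (crResult φ).Adj u w ↔
      G.Adj u w ∨ ∃ i, u = φ (.inr i) ∧ w = φ (.inr (i + 2)) := by
  have ne : ∀ {i j : ZMod 4}, i ≠ j → φ (.inr i) ≠ φ (.inr j) := fun h =>
    φ.injective.ne (Sum.inr_injective.ne h)
  have four : ∀ p : ZMod 4 → Prop, (∃ i, p i) ↔ (p 1 ∨ p 3) ∨ p 2 ∨ p 4 := by
    intro p
    constructor
    · rintro ⟨i, hi⟩
      have h : ∀ i : ZMod 4, (i = 1 ∨ i = 3) ∨ i = 2 ∨ i = 4 := by decide
      rcases h i with (rfl | rfl) | rfl | rfl <;> simp [hi]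
    · grind
  have h₁ : (1 : ZMod 4) + 2 = 3 := by decide
  have h₂ : (2 : ZMod 4) + 2 = 4 := by decide
  have h₃ : (3 : ZMod 4) + 2 = 1 := by decide
  have h₄ : (4 : ZMod 4) + 2 = 2 := by decide
  have h₁₃ := ne (show (1 : ZMod 4) ≠ 3 by decide)
  have h₂₄ := ne (show (2 : ZMod 4) ≠ 4 by decide)
  rw [four, h₁, h₂, h₃, h₄]
  simp only [crResult, SimpleGraph.comap_adj, SimpleGraph.sup_adj, SimpleGraph.edge_adj,
    Function.Embedding.subtype_apply]
  grind

/-- An isomorphism between the ambient graphs carries the result of a `CR`-reduction to the result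
of the transported reduction. -/
def crResultIso (φ : SimpleGraph.Copy crossedCube H) (e : H ≃g G) :
    crResult φ ≃g crResult (e.toCopy.comp φ) where
  toEquiv := e.toEquiv.subtypeEquiv fun u => by simp
  map_rel_iff' := by
    intro u w
    rw [crResult_adj, crResult_adj]
    simp [e.map_adj_iff]

lemma CRStep.of_iso {A A' B : BundledGraph} (e : A.graph ≃g A'.graph) (h : CRStep A B) :
    CRStep A' B := by
  obtain ⟨φ, hφ, ⟨f⟩⟩ := h
  exact ⟨e.toCopy.comp φ, hφ.iso_comp e, ⟨(crResultIso φ e).symm.trans f⟩⟩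

lemma not_crFeasible_of_forall_isCandidate (hV : Nat.card V = 8) (hG : ∀ v, IsCandidate G v)
    (φ : SimpleGraph.Copy crossedCube G) : ¬ CRFeasible φ := by
  intro hφ
  have : Finite V := Nat.finite_of_card_ne_zero (by omega)
  have compl_card : ∀ v, (G.neighborSet v)ᶜ.ncard = 2 := fun v => by
    have := Set.ncard_add_ncard_compl (G.neighborSet v)
    have := hG v
    rw [IsCandidate] at this
    omega
  have opposite : ∀ i, φ (.inr i) ≠ φ (.inr (i + 2)) := fun i =>
    φ.injective.ne (Sum.inr_injective.ne (zmod_four_ne_add_two i))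
  have surj : Function.Surjective φ :=
    ((Nat.bijective_iff_injective_and_card φ).2 ⟨φ.injective, by simp [hV]⟩).2
  have compl_inr : ∀ i,
      (G.neighborSet (φ (.inr i)))ᶜ = {φ (.inr i), φ (.inr (i + 2))} := fun i => by
    refine (Set.eq_of_subset_of_ncard_le ?_ ?_ (Set.toFinite _)).symm
    · rintro _ (rfl | rfl)
      · simp
      · exact hφ.not_adj_inr_add_two i
    · rw [compl_card, Set.ncard_pair (opposite i)]
  have adj : ∀ z, z ≠ Sum.inl 0 → G.Adj (φ (.inl 0)) (φ z) := by
    rintro (i | i) hi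
    · exact φ.toHom.map_adj (crossedCube_adj_inl_inl.2 fun h => hi (by rw [h]))
    · by_contra h
      have : φ (.inl 0) ∈ (G.neighborSet (φ (.inr i)))ᶜ := fun h' => h (G.adj_symm h')
      rw [compl_inr] at this
      rcases this with h' | h' <;> exact Sum.inl_ne_inr (φ.injective h')
  have : (G.neighborSet (φ (.inl 0)))ᶜ ⊆ {φ (.inl 0)} := by
    intro v hv
    obtain ⟨z, rfl⟩ := surj v
    by_contra hz
    exact hv (adj z fun h => hz (by rw [h]; rfl))
  have := Set.ncard_le_ncard this
  rw [compl_card, Set.ncard_singleton] at this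
  omega

end CrossedCube

/-- The level `i` is the innermost or the outermost one of `m` levels. -/
def IsEndLevel {m : ℕ} (i : Fin m) : Prop := i.val = 0 ∨ i.val + 1 = m

section NestedQuadrangles

variable {m : ℕ}

lemma nestedQuadrangles_adj {u w : Fin m × ZMod 4} :
    (nestedQuadrangles m).Adj u w ↔
      u ≠ w ∧ (u.1.val ≤ w.1.val + 1 ∧ w.1.val ≤ u.1.val + 1) ∧
        (w.2 = u.2 + 2 → u.1 = w.1 ∧ IsEndLevel u.1) := by
  obtain ⟨i, a⟩ := u
  obtain ⟨j, b⟩ := w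
  have neighbor : a = b ∨ b = a + 1 ∨ b = a - 1 ∨ b = a + 2 := by decide +revert
  have succ_ne : ∀ a : ZMod 4, a ≠ a + 1 ∧ a ≠ a - 1 ∧ a ≠ a + 2 ∧ a + 1 ≠ a + 2 ∧
      a - 1 ≠ a + 2 ∧ a + 1 ≠ a - 1 := by decide
  have symm : (a = b + 1 ↔ b = a - 1) ∧ (a = b - 1 ↔ b = a + 1) ∧ (a = b + 2 ↔ b = a + 2) := by
    clear neighbor succ_ne
    decide +revert
  simp only [nestedQuadrangles, SimpleGraph.fromRel_adj, ne_eq, Prod.mk.injEq, IsEndLevel,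
    Fin.ext_iff]
  grind

lemma eq_add_two_of_not_adj {u w : Fin m × ZMod 4} (hne : u ≠ w)
    (hlevel : u.1.val ≤ w.1.val + 1 ∧ w.1.val ≤ u.1.val + 1)
    (h : ¬ (nestedQuadrangles m).Adj u w) : w.2 = u.2 + 2 := by
  by_contra hopp
  exact h (nestedQuadrangles_adj.2 ⟨hne, hlevel, fun h => absurd h hopp⟩)

lemma nestedQuadrangles_neighborSet (i : Fin m) (a : ZMod 4) :
    (nestedQuadrangles m).neighborSet (i, a) =
      {i} ×ˢ {b | b ≠ a ∧ (b = a + 2 → IsEndLevel i)} ∪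
        {j : Fin m | i.val + 1 = j.val ∨ j.val + 1 = i.val} ×ˢ {b | b ≠ a + 2} := by
  ext ⟨j, b⟩
  simp only [SimpleGraph.mem_neighborSet, nestedQuadrangles_adj, Set.mem_union, Set.mem_prod,
    Set.mem_singleton_iff, Set.mem_ofPred_eq, ne_eq, Prod.mk.injEq, Fin.ext_iff]
  grind

lemma ncard_neighborSet_nestedQuadrangles (i : Fin m) (a : ZMod 4) :
    ((nestedQuadrangles m).neighborSet (i, a)).ncard =
      {b : ZMod 4 | b ≠ a ∧ (b = a + 2 → IsEndLevel i)}.ncard +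
        {j : Fin m | i.val + 1 = j.val ∨ j.val + 1 = i.val}.ncard * 3 := by
  have three : {b : ZMod 4 | b ≠ a + 2}.ncard = 3 := by
    rw [Set.ncard_eq_toFinset_card']
    decide +revert
  rw [nestedQuadrangles_neighborSet, Set.ncard_union_eq, Set.ncard_prod, Set.ncard_prod,
    Set.ncard_singleton, three, one_mul]
  rw [Set.disjoint_left]
  rintro ⟨j, b⟩ ⟨rfl, -⟩ ⟨h | h, -⟩ <;> simp at h

lemma ncard_neighborSet_of_isEndLevel (hm : 2 ≤ m) {i : Fin m} (hi : IsEndLevel i) (a : ZMod 4) :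
    ((nestedQuadrangles m).neighborSet (i, a)).ncard = 6 := by
  have columns : {b : ZMod 4 | b ≠ a ∧ (b = a + 2 → IsEndLevel i)}.ncard = 3 := by
    simp only [hi, implies_true, and_true]
    rw [Set.ncard_eq_toFinset_card']
    decide +revert
  have levels : {j : Fin m | i.val + 1 = j.val ∨ j.val + 1 = i.val}.ncard = 1 := by
    rw [Set.ncard_eq_one]
    rcases hi with hi | hi
    · refine ⟨⟨1, by omega⟩, ?_⟩
      ext j
      simp only [Set.mem_ofPred_eq, Set.mem_singleton_iff, Fin.ext_iff]
      omega
    · refine ⟨⟨m - 2, by omega⟩, ?_⟩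
      ext j
      simp only [Set.mem_ofPred_eq, Set.mem_singleton_iff, Fin.ext_iff]
      omega
  rw [ncard_neighborSet_nestedQuadrangles, columns, levels]

lemma ncard_neighborSet_of_not_isEndLevel {i : Fin m} (hi : ¬ IsEndLevel i) (a : ZMod 4) :
    ((nestedQuadrangles m).neighborSet (i, a)).ncard = 8 := by
  have columns : {b : ZMod 4 | b ≠ a ∧ (b = a + 2 → IsEndLevel i)}.ncard = 2 := by
    simp only [hi, imp_false]
    rw [Set.ncard_eq_toFinset_card']
    decide +revert
  have levels : {j : Fin m | i.val + 1 = j.val ∨ j.val + 1 = i.val}.ncard = 2 := by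
    rw [IsEndLevel, not_or] at hi
    refine Set.ncard_eq_two.2 ⟨⟨i.val - 1, by omega⟩, ⟨i.val + 1, by omega⟩, ?_, ?_⟩
    · simp only [ne_eq, Fin.ext_iff]
      omega
    · ext j
      simp only [Set.mem_ofPred_eq, Set.mem_insert_iff, Set.mem_singleton_iff, Fin.ext_iff]
      omega
  rw [ncard_neighborSet_nestedQuadrangles, columns, levels]

lemma isCandidate_nestedQuadrangles_iff (hm : 2 ≤ m) (u : Fin m × ZMod 4) :
    IsCandidate (nestedQuadrangles m) u ↔ IsEndLevel u.1 := by
  obtain ⟨i, a⟩ := u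
  by_cases hi : IsEndLevel i
  · simp [IsCandidate, ncard_neighborSet_of_isEndLevel hm hi, hi]
  · simp [IsCandidate, ncard_neighborSet_of_not_isEndLevel hi, hi]

lemma card_fin_prod_zmod_four (m : ℕ) : Nat.card (Fin m × ZMod 4) = 4 * m := by
  rw [Nat.card_prod, Nat.card_zmod, Nat.card_fin, mul_comm]

open Classical in
lemma sum_isEndLevel (hm : 2 ≤ m) : ∑ i : Fin m, (if IsEndLevel i then 1 else 0) = 2 := by
  obtain ⟨n, rfl⟩ := Nat.exists_eq_add_of_le' hm
  simp [Fin.sum_univ_succ (n := n + 1), Fin.sum_univ_castSucc (n := n), IsEndLevel,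
    (Fin.isLt _).ne]

lemma ncard_edgeSet_nestedQuadrangles (hm : 2 ≤ m) :
    (nestedQuadrangles m).edgeSet.ncard + 8 = 4 * (4 * m) := by
  classical
  have degree_add : ∀ u : Fin m × ZMod 4,
      (nestedQuadrangles m).degree u + 2 * (if IsEndLevel u.1 then 1 else 0) = 8 := by
    rintro ⟨i, a⟩
    rw [← SimpleGraph.card_neighborSet_eq_degree, ← Nat.card_eq_fintype_card, Nat.card_coe_set_eq]
    by_cases hi : IsEndLevel i
    · simp [ncard_neighborSet_of_isEndLevel hm hi, hi]
    · simp [ncard_neighborSet_of_not_isEndLevel hi, hi]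
  have sum_degree_add := Fintype.sum_congr _ _ degree_add
  have handshake := (nestedQuadrangles m).sum_degrees_eq_twice_card_edges
  have sum_end : ∑ u : Fin m × ZMod 4, (if IsEndLevel u.1 then 1 else 0) = 8 := by
    rw [Fintype.sum_prod_type_right]
    simp [sum_isEndLevel hm, ZMod.card]
  rw [Finset.sum_add_distrib, handshake, ← Finset.mul_sum, sum_end, Finset.sum_const,
    Finset.card_univ, Fintype.card_prod, Fintype.card_fin, ZMod.card, smul_eq_mul] at sum_degree_add
  rw [Set.ncard_eq_toFinset_card', ← SimpleGraph.edgeFinset]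
  omega

end NestedQuadrangles

section Drawing

lemma isOnePlanar_of_arcs {V E : Type} {G : SimpleGraph V} {pos : V → ℝ × ℝ} {ends : E → Sym2 V}
    {arc : E → ℝ → ℝ × ℝ} (hpos : Function.Injective pos)
    (hends : ∀ x ∈ G.edgeSet, ∃ d, ends d = x)
    (hcont : ∀ d, ContinuousOn (arc d) (Set.Icc 0 1))
    (hinj : ∀ d, Set.InjOn (arc d) (Set.Icc 0 1))
    (hendpoints : ∀ d, s(arc d 0, arc d 1) = (ends d).map pos)
    (havoid : ∀ d v, pos v ∉ openArc (arc d))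
    (hcross : ∀ c d e, d ≠ c → e ≠ c → ∀ p ∈ openArc (arc c) ∩ openArc (arc d),
      ∀ q ∈ openArc (arc c) ∩ openArc (arc e), d = e ∧ p = q) :
    IsOnePlanar G := by
  have exists_curve : ∀ x ∈ G.edgeSet, ∃ γ d, ends d = x ∧ γ = arc d := fun x hx =>
    let ⟨d, hd⟩ := hends x hx
    ⟨arc d, d, hd, rfl⟩
  choose! curve hcurve using exists_curve
  refine ⟨⟨pos, curve, hpos, fun x hx => ?_, fun x hx => ?_, fun x hx => ?_, fun x hx => ?_,
    fun x hx y hy z hz hyx hzx => ?_⟩⟩ <;> obtain ⟨c, rfl, hc⟩ := hcurve x hx <;> rw [hc]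
  · exact hcont c
  · exact hinj c
  · exact hendpoints c
  · exact havoid c
  · obtain ⟨d, rfl, hd⟩ := hcurve y hy
    obtain ⟨e, rfl, he⟩ := hcurve z hz
    rw [hd, he]
    intro p hp q hq
    exact (hcross c d e (ne_of_apply_ne ends hyx) (ne_of_apply_ne ends hzx) p hp q hq).imp_left
      (congrArg ends)

/-- The covering of the punctured plane by the plane of logarithmic polar coordinates (the logarithm
of the radius and the angle), the angle being measured in quarter turns. -/
noncomputable def polarMap (p : ℝ × ℝ) : ℝ × ℝ :=
  Complex.equivRealProdCLM (Complex.exp (p.1 + p.2 * (Real.pi / 2) * Complex.I))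

lemma continuous_polarMap : Continuous polarMap := by
  unfold polarMap
  fun_prop

lemma polarMap_add_four (r t : ℝ) : polarMap (r, t + 4) = polarMap (r, t) := by
  have h : (r + (t + 4 : ℝ) * (Real.pi / 2) * Complex.I : ℂ) =
      r + t * (Real.pi / 2) * Complex.I + 2 * Real.pi * Complex.I := by
    push_cast
    ring
  rw [polarMap, h, Complex.exp_periodic, polarMap]

lemma eq_of_polarMap_eq {p q : ℝ × ℝ} (h : polarMap p = polarMap q) (hpq : |p.2 - q.2| < 4) :
    p = q := by
  obtain ⟨n, hn⟩ :=
    Complex.exp_eq_exp_iff_exists_int.1 (Complex.equivRealProdCLM.injective h)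
  have radius : p.1 = q.1 := by simpa using congrArg Complex.re hn
  have angle : p.2 - q.2 = n * 4 := by
    have him : p.2 * (Real.pi / 2) = q.2 * (Real.pi / 2) + n * (2 * Real.pi) := by
      simpa using congrArg Complex.im hn
    apply mul_right_cancel₀ Real.pi_ne_zero
    linarith
  have hn0 : n = 0 := by
    rw [angle, abs_mul, abs_of_pos (four_pos : (0 : ℝ) < 4)] at hpq
    have : |(n : ℝ)| < 1 := by linarith
    exact Int.abs_lt_one_iff.1 (by exact_mod_cast this)
  have angle_eq : p.2 = q.2 := by
    rw [hn0, Int.cast_zero, zero_mul] at angle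
    exact sub_eq_zero.1 angle
  exact Prod.ext radius angle_eq

lemma injOn_polarMap : Set.InjOn polarMap {p | p.2 ∈ Set.Ico 0 4} := fun _ hp _ hq h =>
  eq_of_polarMap_eq h (abs_sub_lt_of_nonneg_of_lt hp.1 hp.2 hq.1 hq.2)

/-- The edges of the nested crossed quadrangles, by their position in the drawing: those of the
4-cycles, the planar and the crossing ones of the kites between consecutive levels `i` and `j`, and
the diagonals of the end levels. The two edges of a pair of crossing edges differ in the Boolean. -/
inductive NestedEdge (m : ℕ) : Type
  | cycle (i : Fin m) (a : ZMod 4)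
  | radial (i j : Fin m) (h : i.val + 1 = j.val) (a : ZMod 4)
  | cross (i j : Fin m) (h : i.val + 1 = j.val) (a : ZMod 4) (b : Bool)
  | diagonal (i : Fin m) (h : IsEndLevel i) (b : Bool)

/-- The position of a vertex of the nested crossed quadrangles in the drawing. -/
noncomputable def nestedPos {m : ℕ} (u : Fin m × ZMod 4) : ℝ × ℝ :=
  polarMap (u.1.val, u.2.val)

/-- The number of the cell of a real number with respect to the subdivision of the line by the
integers: `2 n` for the integer `n` and `2 n + 1` for the interval between `n` and `n + 1`. -/
noncomputable def lineCell (x : ℝ) : ℤ := ⌊x⌋ + ⌈x⌉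

/-- The cell of a point of the plane of logarithmic polar coordinates with respect to the
subdivision by the 4-cycles and the radial edges of the nested crossed quadrangles. The faces inside
the innermost and outside the outermost 4-cycle are not subdivided: their second entry is `none`. -/
noncomputable def planeCell (m : ℕ) (p : ℝ × ℝ) : ℤ × Option ℤ :=
  (lineCell p.1, if lineCell p.1 = -1 ∨ lineCell p.1 = 2 * m - 1 then none
    else some (lineCell p.2))

lemma lineCell_natCast (n : ℕ) : lineCell n = 2 * n := by
  simp [lineCell, two_mul]

lemma lineCell_of_mem_Ioo {x : ℝ} {n : ℤ} (h : x ∈ Set.Ioo (n : ℝ) (n + 1)) :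
    lineCell x = 2 * n + 1 := by
  rw [lineCell, Int.floor_eq_iff.2 ⟨h.1.le, h.2⟩,
    Int.ceil_eq_iff (z := n + 1).2 ⟨by push_cast; linarith [h.1], by push_cast; exact h.2.le⟩]
  ring

lemma zmod_four_val_mem_Icc (a : ZMod 4) : (a.val : ℝ) ∈ Set.Icc 0 3 :=
  ⟨by positivity, by exact_mod_cast Nat.le_of_lt_succ (ZMod.val_lt a)⟩

lemma zmod_four_val_mem_Ico (a : ZMod 4) : (a.val : ℝ) ∈ Set.Ico 0 4 :=
  Set.Icc_subset_Ico_right (by norm_num) (zmod_four_val_mem_Icc a)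

lemma nestedPos_injective {m : ℕ} : Function.Injective (nestedPos (m := m)) := by
  rintro ⟨i, a⟩ ⟨j, b⟩ h
  have := injOn_polarMap (zmod_four_val_mem_Ico a) (zmod_four_val_mem_Ico b) h
  simp only [Prod.mk.injEq, Nat.cast_inj] at this
  exact Prod.ext (Fin.ext this.1) (ZMod.val_injective 4 this.2)

lemma nestedPos_add_one {m : ℕ} (i : Fin m) (a : ZMod 4) :
    nestedPos (i, a + 1) = polarMap (i.val, a.val + 1) := by
  have wrap : (a + 1).val = a.val + 1 ∨ a.val + 1 = (a + 1).val + 4 := by decide +revert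
  unfold nestedPos
  rcases wrap with h | h
  · rw [h, Nat.cast_add_one]
  · have h' : (a.val : ℝ) + 1 = (a + 1).val + 4 := by exact_mod_cast h
    rw [h', polarMap_add_four]

namespace NestedEdge

variable {m : ℕ}

/-- The two endpoints of an edge. -/
def ends : NestedEdge m → Sym2 (Fin m × ZMod 4)
  | cycle i a => s((i, a), (i, a + 1))
  | radial i j _ a => s((i, a), (j, a))
  | cross i j _ a false => s((i, a), (j, a + 1))
  | cross i j _ a true => s((i, a + 1), (j, a))
  | diagonal i _ false => s((i, 0), (i, 2))
  | diagonal i _ true => s((i, 1), (i, 3))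

/-- The radial direction in which the diagonals of an end level are bent: inwards at level `0`. -/
def bulge (i : Fin m) : ℝ := if i.val = 0 then -1 else 1

/-- The curve of an edge in logarithmic polar coordinates. -/
noncomputable def lift : NestedEdge m → ℝ → ℝ × ℝ
  | cycle i a, s => (i.val, a.val + s)
  | radial i _ _ a, s => (i.val + s, a.val)
  | cross i _ _ a false, s => (i.val + s, a.val + s)
  | cross i _ _ a true, s => (i.val + s, a.val + 1 - s)
  | diagonal i _ false, s => (i.val + bulge i * (s * (1 - s)), 2 * s)
  | diagonal i _ true, s => (i.val + bulge i * (s * (1 - s)), 1 + 2 * s)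

/-- The curve of an edge in the plane. -/
noncomputable def arc (d : NestedEdge m) (s : ℝ) : ℝ × ℝ := polarMap (d.lift s)

/-- The other edge of the same kite, if there is one, and the edge itself otherwise. -/
def partner : NestedEdge m → NestedEdge m
  | cycle i a => cycle i a
  | radial i j h a => radial i j h a
  | cross i j h a b => cross i j h a (!b)
  | diagonal i h b => diagonal i h (!b)

/-- The cell, in the sense of `planeCell`, in which the interior of the curve of an edge lies. -/
def cell : NestedEdge m → ℤ × Option ℤ
  | cycle i a => (2 * i.val, some (2 * a.val + 1))
  | radial i _ _ a => (2 * i.val + 1, some (2 * a.val))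
  | cross i _ _ a _ => (2 * i.val + 1, some (2 * a.val + 1))
  | diagonal i _ _ => (if i.val = 0 then -1 else 2 * i.val + 1, none)

lemma exists_ends_eq_of_succ {i j : Fin m} (hij : i.val + 1 = j.val) {a b : ZMod 4}
    (hab : b ≠ a + 2) : ∃ d : NestedEdge m, d.ends = s((i, a), (j, b)) := by
  have columns : b = a ∨ b = a + 1 ∨ a = b + 1 := by decide +revert
  rcases columns with rfl | rfl | rfl
  · exact ⟨radial i j hij b, rfl⟩
  · exact ⟨cross i j hij a false, rfl⟩
  · exact ⟨cross i j hij b true, rfl⟩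

lemma exists_ends_eq_of_same_level (i : Fin m) {a b : ZMod 4} (hne : b ≠ a)
    (hab : b = a + 2 → IsEndLevel i) : ∃ d : NestedEdge m, d.ends = s((i, a), (i, b)) := by
  have columns : b = a + 1 ∨ a = b + 1 ∨ b = a + 2 := by
    clear hab
    decide +revert
  rcases columns with rfl | rfl | rfl
  · exact ⟨cycle i a, rfl⟩
  · exact ⟨cycle i b, Sym2.eq_swap⟩
  · fin_cases a
    · exact ⟨diagonal i (hab rfl) false, rfl⟩
    · exact ⟨diagonal i (hab rfl) true, rfl⟩
    · exact ⟨diagonal i (hab rfl) false, Sym2.eq_swap⟩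
    · exact ⟨diagonal i (hab rfl) true, Sym2.eq_swap⟩

lemma exists_ends_eq {x : Sym2 (Fin m × ZMod 4)} (hx : x ∈ (nestedQuadrangles m).edgeSet) :
    ∃ d : NestedEdge m, d.ends = x := by
  induction x using Sym2.ind with
  | _ u w =>
  obtain ⟨i, a⟩ := u
  obtain ⟨j, b⟩ := w
  have add_two_comm : b = a + 2 ↔ a = b + 2 := by
    clear hx
    decide +revert
  rw [SimpleGraph.mem_edgeSet, nestedQuadrangles_adj] at hx
  obtain ⟨hne, hlevel, hopp⟩ := hx
  dsimp only at hlevel hopp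
  obtain hij | hij | hij : i = j ∨ i.val + 1 = j.val ∨ j.val + 1 = i.val := by
    simp only [Fin.ext_iff]
    omega
  · subst hij
    exact exists_ends_eq_of_same_level i (fun h => hne (by rw [h])) fun h => (hopp h).2
  · exact exists_ends_eq_of_succ hij fun h => by
      rw [(hopp h).1] at hij
      omega
  · rw [Sym2.eq_swap]
    exact exists_ends_eq_of_succ hij fun h => by
      rw [(hopp (add_two_comm.2 h)).1] at hij
      omega

lemma continuous_arc (d : NestedEdge m) : Continuous d.arc := by
  have continuous_lift : Continuous fun s => ((d.lift s).1, (d.lift s).2) := by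
    rcases d with ⟨i, a⟩ | ⟨i, j, h, a⟩ | ⟨i, j, h, a, _ | _⟩ | ⟨i, h, _ | _⟩ <;>
      simp only [lift] <;> fun_prop
  exact continuous_polarMap.comp continuous_lift

lemma injOn_arc (d : NestedEdge m) : Set.InjOn d.arc (Set.Icc 0 1) := by
  rintro s ⟨hs₀, hs₁⟩ t ⟨ht₀, ht₁⟩ h
  have lift_injective : Function.Injective d.lift := fun s t h => by
    rcases d with ⟨i, a⟩ | ⟨i, j, h, a⟩ | ⟨i, j, h, a, _ | _⟩ | ⟨i, h, _ | _⟩ <;>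
      simp only [lift, Prod.mk.injEq] at h <;> linarith
  refine lift_injective (eq_of_polarMap_eq h ?_)
  rw [abs_lt]
  rcases d with ⟨i, a⟩ | ⟨i, j, h, a⟩ | ⟨i, j, h, a, _ | _⟩ | ⟨i, h, _ | _⟩ <;>
    simp only [lift] <;> constructor <;> linarith

lemma arc_endpoints (d : NestedEdge m) : s(d.arc 0, d.arc 1) = d.ends.map nestedPos := by
  rcases d with ⟨i, a⟩ | ⟨i, j, h, a⟩ | ⟨i, j, h, a, _ | _⟩ | ⟨i, h, _ | _⟩ <;>
    simp only [ends, Sym2.map_mk, nestedPos_add_one, arc, lift]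
  · simp [nestedPos]
  · simp [nestedPos, ← h]
  · simp [nestedPos, ← h]
  · simp [nestedPos, ← h]
  · norm_num [nestedPos, show ZMod.val (2 : ZMod 4) = 2 from rfl]
  · norm_num [nestedPos, show ZMod.val (1 : ZMod 4) = 1 from rfl,
      show ZMod.val (3 : ZMod 4) = 3 from rfl]

lemma lift_snd_mem (d : NestedEdge m) {s : ℝ} (hs : s ∈ Set.Ioo (0 : ℝ) 1) :
    (d.lift s).2 ∈ Set.Ico (0 : ℝ) 4 := by
  obtain ⟨h₀, h₁⟩ := hs
  have column := zmod_four_val_mem_Icc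
  rcases d with ⟨i, a⟩ | ⟨i, j, h, a⟩ | ⟨i, j, h, a, _ | _⟩ | ⟨i, h, _ | _⟩ <;>
    simp only [lift, Set.mem_Ico] <;> constructor <;>
    first | linarith | linarith [(column a).1, (column a).2]

lemma lineCell_lift_diagonal (i : Fin m) {s : ℝ} (hs : s ∈ Set.Ioo (0 : ℝ) 1) :
    lineCell (i.val + bulge i * (s * (1 - s))) =
      if i.val = 0 then -1 else 2 * (i.val : ℤ) + 1 := by
  have pos : 0 < s * (1 - s) := mul_pos hs.1 (sub_pos.2 hs.2)
  have lt_one : s * (1 - s) < 1 := by nlinarith [hs.1, hs.2]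
  by_cases hi : i.val = 0
  · rw [if_pos hi, bulge, if_pos hi, hi, Nat.cast_zero, zero_add, neg_one_mul]
    refine lineCell_of_mem_Ioo (n := -1) ⟨?_, ?_⟩ <;> push_cast <;> linarith
  · rw [if_neg hi, bulge, if_neg hi, one_mul]
    refine lineCell_of_mem_Ioo (n := i.val) ⟨?_, ?_⟩ <;> push_cast <;> linarith

lemma planeCell_lift (d : NestedEdge m) {s : ℝ} (hs : s ∈ Set.Ioo (0 : ℝ) 1) :
    planeCell m (d.lift s) = d.cell := by
  have up : ∀ n : ℕ, lineCell (n + s) = 2 * n + 1 := fun n =>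
    lineCell_of_mem_Ioo (n := n) ⟨by push_cast; linarith [hs.1], by push_cast; linarith [hs.2]⟩
  have down : ∀ n : ℕ, lineCell (n + 1 - s) = 2 * n + 1 := fun n =>
    lineCell_of_mem_Ioo (n := n) ⟨by push_cast; linarith [hs.2], by push_cast; linarith [hs.1]⟩
  rcases d with ⟨i, a⟩ | ⟨i, j, h, a⟩ | ⟨i, j, h, a, _ | _⟩ | ⟨i, h, _ | _⟩ <;>
    simp only [lift, cell, planeCell, lineCell_natCast, up, down, lineCell_lift_diagonal i hs]
  · rw [if_neg (by omega)]
  · rw [if_neg (by omega)]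
  · rw [if_neg (by omega)]
  · rw [if_neg (by omega)]
  all_goals
    have outside : (if i.val = 0 then -1 else 2 * (i.val : ℤ) + 1) = -1 ∨
        (if i.val = 0 then -1 else 2 * (i.val : ℤ) + 1) = 2 * m - 1 := by
      rw [IsEndLevel] at h
      split_ifs <;> omega
    rw [if_pos outside]

lemma nestedPos_notMem_openArc (d : NestedEdge m) (u : Fin m × ZMod 4) :
    nestedPos u ∉ openArc d.arc := by
  rintro ⟨s, hs, h⟩
  have lift_eq : d.lift s = ((u.1.val : ℝ), (u.2.val : ℝ)) :=
    injOn_polarMap (d.lift_snd_mem hs) (zmod_four_val_mem_Ico u.2) h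
  have cell_eq := d.planeCell_lift hs
  rw [lift_eq, planeCell, lineCell_natCast, lineCell_natCast, if_neg (by omega)] at cell_eq
  cases d <;> simp only [cell, Prod.mk.injEq, Option.some.injEq, reduceCtorEq, and_false]
    at cell_eq <;> omega

lemma eq_or_eq_partner_of_cell_eq {d e : NestedEdge m} (h : d.cell = e.cell) :
    e = d ∨ e = d.partner := by
  have val_inj : ∀ {a b : ZMod 4}, a.val = b.val → a = b := fun h => ZMod.val_injective 4 h
  cases d <;> cases e <;> simp only [cell, Prod.mk.injEq, Option.some.injEq, reduceCtorEq,
    and_false, and_true] at h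
  case cycle.cycle i a j b =>
    left
    rw [Fin.ext (by omega : i.val = j.val), val_inj (by omega : a.val = b.val)]
  case radial.radial i j hij a i' j' hij' a' =>
    left
    obtain rfl : i = i' := Fin.ext (by omega)
    obtain rfl : j = j' := Fin.ext (by omega)
    rw [val_inj (by omega : a.val = a'.val)]
  case cross.cross i j hij a b i' j' hij' a' b' =>
    obtain rfl : i = i' := Fin.ext (by omega)
    obtain rfl : j = j' := Fin.ext (by omega)
    obtain rfl : a = a' := val_inj (by omega)
    cases b <;> cases b' <;> simp [partner]
  case diagonal.diagonal i hi b i' hi' b' =>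
    obtain rfl : i = i' := Fin.ext (by split_ifs at h <;> omega)
    cases b <;> cases b' <;> simp [partner]
  all_goals omega

lemma eq_of_lift_eq_lift_partner {d : NestedEdge m} (hd : d.partner ≠ d) {s s' t t' : ℝ}
    (hs : d.lift s = d.partner.lift s') (ht : d.lift t = d.partner.lift t') : s = t := by
  have bulge_ne_zero : ∀ i : Fin m, bulge i ≠ 0 := fun i => by
    rw [bulge]
    split_ifs <;> norm_num
  rcases d with ⟨i, a⟩ | ⟨i, j, h, a⟩ | ⟨i, j, h, a, _ | _⟩ | ⟨i, h, _ | _⟩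
  · exact absurd rfl hd
  · exact absurd rfl hd
  all_goals
    simp only [partner, lift, Bool.not_true, Bool.not_false, Prod.mk.injEq, add_right_inj,
      mul_eq_mul_left_iff, bulge_ne_zero, or_false] at hs ht
  · linarith
  · linarith
  · obtain rfl : s = s' + 1 / 2 := by linarith
    obtain rfl : t = t' + 1 / 2 := by linarith
    linarith
  · obtain rfl : s' = s + 1 / 2 := by linarith
    obtain rfl : t' = t + 1 / 2 := by linarith
    linarith

lemma exists_lift_eq_lift_partner {d e : NestedEdge m} (hne : e ≠ d) {p : ℝ × ℝ}
    (hp : p ∈ openArc d.arc ∩ openArc e.arc) :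
    e = d.partner ∧ ∃ s s', p = d.arc s ∧ d.lift s = d.partner.lift s' := by
  obtain ⟨⟨s, hs, rfl⟩, ⟨s', hs', h⟩⟩ := hp
  have lift_eq : d.lift s = e.lift s' :=
    injOn_polarMap (d.lift_snd_mem hs) (e.lift_snd_mem hs') h.symm
  have cell_eq : d.cell = e.cell := by
    rw [← d.planeCell_lift hs, lift_eq, e.planeCell_lift hs']
  obtain rfl := (eq_or_eq_partner_of_cell_eq cell_eq).resolve_left hne
  exact ⟨rfl, s, s', rfl, lift_eq⟩

end NestedEdge

lemma isOnePlanar_nestedQuadrangles (m : ℕ) : IsOnePlanar (nestedQuadrangles m) := by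
  refine isOnePlanar_of_arcs nestedPos_injective (fun _ => NestedEdge.exists_ends_eq)
    (fun d => d.continuous_arc.continuousOn) NestedEdge.injOn_arc NestedEdge.arc_endpoints
    NestedEdge.nestedPos_notMem_openArc fun c d e hd he p hp q hq => ?_
  obtain ⟨rfl, s, s', rfl, hs⟩ := NestedEdge.exists_lift_eq_lift_partner hd hp
  obtain ⟨rfl, t, t', rfl, ht⟩ := NestedEdge.exists_lift_eq_lift_partner he hq
  exact ⟨rfl, by rw [NestedEdge.eq_of_lift_eq_lift_partner hd hs ht]⟩

lemma isOptimalOnePlanar_nestedQuadrangles {m : ℕ} (hm : 2 ≤ m) :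
    IsOptimalOnePlanar (nestedQuadrangles m) := by
  refine ⟨inferInstance, ?_, isOnePlanar_nestedQuadrangles m, ?_⟩
  · rw [card_fin_prod_zmod_four]
    omega
  · rw [ncard_edgeSet_nestedQuadrangles hm, card_fin_prod_zmod_four]

end Drawing

section Reductions

variable {m : ℕ}

lemma eq_add_two_of_common_neighbor {x y z : Fin m × ZMod 4} (hx : IsEndLevel x.1)
    (hy : (nestedQuadrangles m).Adj x y) (hz : (nestedQuadrangles m).Adj x z) (hne : y ≠ z)
    (h : ¬ (nestedQuadrangles m).Adj y z) : z.2 = y.2 + 2 := by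
  rw [nestedQuadrangles_adj] at hy hz
  rw [IsEndLevel] at hx
  exact eq_add_two_of_not_adj hne (by omega) h

lemma not_srFeasible_nestedQuadrangles (hm : 2 ≤ m)
    (φ : SimpleGraph.Copy crossedStar (nestedQuadrangles m)) : ¬ SRFeasible φ := by
  rintro ⟨hx, h₂, h₆, h₁⟩
  rw [isCandidate_nestedQuadrangles_iff hm] at hx
  have adj_center : ∀ i, (nestedQuadrangles m).Adj (φ none) (φ (some i)) := fun i =>
    φ.toHom.map_adj (by simp [crossedStar])
  have ne : ∀ {i j : ZMod 6}, i ≠ j → φ (some i) ≠ φ (some j) := fun hij =>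
    φ.injective.ne ((Option.some_injective _).ne hij)
  have column : ∀ i : ZMod 6, i ≠ 4 → ¬ (nestedQuadrangles m).Adj (φ (some i)) (φ (some 4)) →
      (φ (some i)).2 + 2 = (φ (some 4)).2 := fun i hi h =>
    (eq_add_two_of_common_neighbor hx (adj_center i) (adj_center 4) (ne hi) h).symm
  have level_ne : ∀ i j : ZMod 6, i ≠ j → (φ (some i)).2 + 2 = (φ (some 4)).2 →
      (φ (some j)).2 + 2 = (φ (some 4)).2 → (φ (some i)).1.val ≠ (φ (some j)).1.val :=
    fun i j hij hi hj h => ne hij (Prod.ext (Fin.ext h) (add_right_cancel (hi.trans hj.symm)))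
  have column₁ := column 1 (by decide) h₁
  have column₂ := column 2 (by decide) h₂
  have column₆ := column 6 (by decide) h₆
  have level₁₂ := level_ne 1 2 (by decide) column₁ column₂
  have level₁₆ := level_ne 1 6 (by decide) column₁ column₆
  have level₂₆ := level_ne 2 6 (by decide) column₂ column₆
  have level_near := fun i => (nestedQuadrangles_adj.1 (adj_center i)).2.1
  have near₁ := level_near 1
  have near₂ := level_near 2
  have near₆ := level_near 6
  rw [IsEndLevel] at hx
  omega

/-- The automorphism that reverses the order of the levels. -/
def reverseLevels (m : ℕ) : nestedQuadrangles m ≃g nestedQuadrangles m where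
  toEquiv := Fin.revPerm.prodCongr (Equiv.refl _)
  map_rel_iff' := by
    rintro ⟨i, a⟩ ⟨j, b⟩
    simp only [nestedQuadrangles_adj, IsEndLevel, Equiv.prodCongr_apply, Prod.map_apply,
      Fin.revPerm_apply, Equiv.refl_apply, Fin.val_rev, Fin.rev_inj, ne_eq, Prod.mk.injEq]
    have levels :
        (m - (i.val + 1) ≤ m - (j.val + 1) + 1 ∧ m - (j.val + 1) ≤ m - (i.val + 1) + 1) ↔
          (i.val ≤ j.val + 1 ∧ j.val ≤ i.val + 1) := by omega
    have ends : (m - (i.val + 1) = 0 ∨ m - (i.val + 1) + 1 = m) ↔ (i.val = 0 ∨ i.val + 1 = m) := by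
      omega
    rw [levels, ends]

lemma exists_eq_of_injective_of_level {f : ZMod 4 → Fin m × ZMod 4} (hf : Function.Injective f)
    {i : Fin m} (hlevel : ∀ a, (f a).1 = i) {u : Fin m × ZMod 4} (hu : u.1 = i) :
    ∃ a, f a = u := by
  have column_injective : Function.Injective fun a => (f a).2 := fun a b h =>
    hf (Prod.ext ((hlevel a).trans (hlevel b).symm) h)
  obtain ⟨a, ha⟩ := Finite.surjective_of_injective column_injective u.2
  exact ⟨a, Prod.ext ((hlevel a).trans hu.symm) ha⟩

lemma CRFeasible.exists_isEndLevel (hm : 3 ≤ m)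
    {φ : SimpleGraph.Copy crossedCube (nestedQuadrangles m)} (hφ : CRFeasible φ) :
    ∃ l, IsEndLevel l ∧ ∀ i, (φ (.inl i)).1 = l := by
  have isEndLevel : ∀ i, IsEndLevel (φ (.inl i)).1 := fun i =>
    (isCandidate_nestedQuadrangles_iff (by omega) _).1 (hφ.1 i)
  refine ⟨(φ (.inl 0)).1, isEndLevel 0, fun i => ?_⟩
  rcases eq_or_ne i 0 with rfl | hi
  · rfl
  · have adj : (nestedQuadrangles m).Adj (φ (.inl i)) (φ (.inl 0)) :=
      φ.toHom.map_adj (crossedCube_adj_inl_inl.2 hi)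
    have near := (nestedQuadrangles_adj.1 adj).2.1
    have end_i := isEndLevel i
    have end_zero := isEndLevel 0
    rw [IsEndLevel] at end_i end_zero
    exact Fin.ext (by omega)

variable {k : ℕ}

lemma nestedQuadrangles_adj_iff_succ (u w : Fin k × ZMod 4) :
    (nestedQuadrangles k).Adj u w ↔
      (nestedQuadrangles (k + 1)).Adj (u.1.castSucc, u.2) (w.1.castSucc, w.2) ∨
        u.1.val + 1 = k ∧ w.1.val + 1 = k ∧ w.2 = u.2 + 2 := by
  obtain ⟨i, a⟩ := u
  obtain ⟨j, b⟩ := w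
  simp only [nestedQuadrangles_adj, IsEndLevel, ne_eq, Prod.mk.injEq, Fin.ext_iff,
    Fin.val_castSucc]
  grind [zmod_four_ne_add_two]

lemma forall_ne_inl_iff_of_last {φ : SimpleGraph.Copy crossedCube (nestedQuadrangles (k + 1))}
    (hlast : ∀ i, (φ (.inl i)).1 = Fin.last k) (u : Fin (k + 1) × ZMod 4) :
    (∀ i, u ≠ φ (.inl i)) ↔ u.1.val < k := by
  constructor
  · intro h
    by_contra hlt
    have hu : u.1 = Fin.last k := Fin.eq_last_of_not_lt hlt
    obtain ⟨i, hi⟩ := exists_eq_of_injective_of_level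
      (φ.injective.comp Sum.inl_injective) hlast hu
    exact h i hi.symm
  · rintro h i rfl
    rw [hlast i] at h
    exact h.false

lemma inr_level_of_last {φ : SimpleGraph.Copy crossedCube (nestedQuadrangles (k + 1))}
    (hlast : ∀ i, (φ (.inl i)).1 = Fin.last k) (i : ZMod 4) : (φ (.inr i)).1.val + 1 = k := by
  have lt : (φ (.inr i)).1.val < k :=
    (forall_ne_inl_iff_of_last hlast _).1 fun _ h => Sum.inr_ne_inl (φ.injective h)
  have adj : (nestedQuadrangles (k + 1)).Adj (φ (.inl i)) (φ (.inr i)) :=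
    φ.toHom.map_adj (crossedCube_adj_inl_inr.2 (zmod_four_ne_add_two i))
  have near := (nestedQuadrangles_adj.1 adj).2.1
  rw [hlast i, Fin.val_last] at near
  omega

lemma crResult_adj_iff_of_last {φ : SimpleGraph.Copy crossedCube (nestedQuadrangles (k + 1))}
    (hφ : CRFeasible φ) (hlast : ∀ i, (φ (.inl i)).1 = Fin.last k)
    (u w : {u : Fin (k + 1) × ZMod 4 | ∀ i, u ≠ φ (.inl i)}) :
    (crResult φ).Adj u w ↔ (nestedQuadrangles (k + 1)).Adj u w ∨
      u.1.1.val + 1 = k ∧ w.1.1.val + 1 = k ∧ w.1.2 = u.1.2 + 2 := by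
  have level := inr_level_of_last hlast
  have same_level : ∀ {v v' : Fin (k + 1) × ZMod 4}, v.1.val + 1 = k → v'.1.val + 1 = k →
      v.1 = v'.1 := fun h h' => Fin.ext (Nat.succ_injective (h.trans h'.symm))
  have opposite : ∀ i, (φ (.inr (i + 2))).2 = (φ (.inr i)).2 + 2 := fun i =>
    have levels := congrArg Fin.val (same_level (level i) (level (i + 2)))
    eq_add_two_of_not_adj (φ.injective.ne (Sum.inr_injective.ne (zmod_four_ne_add_two i)))
      (by omega) (hφ.not_adj_inr_add_two i)
  rw [crResult_adj]
  refine or_congr_right ⟨?_, ?_⟩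
  · rintro ⟨i, hu, hw⟩
    rw [hu, hw]
    exact ⟨level i, level (i + 2), opposite i⟩
  · rintro ⟨hu, hw, hcolumn⟩
    obtain ⟨i, hi⟩ := exists_eq_of_injective_of_level (φ.injective.comp Sum.inr_injective)
      (fun a => same_level (level a) hu) rfl
    refine ⟨i, hi.symm, Prod.ext (same_level hw (level _)) ?_⟩
    rw [hcolumn, opposite, ← hi]
    rfl

lemma nonempty_crResult_iso_of_last
    {φ : SimpleGraph.Copy crossedCube (nestedQuadrangles (k + 1))} (hφ : CRFeasible φ)
    (hlast : ∀ i, (φ (.inl i)).1 = Fin.last k) :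
    Nonempty (crResult φ ≃g nestedQuadrangles k) := by
  have remaining := forall_ne_inl_iff_of_last hlast
  let levelsEquiv : {u : Fin (k + 1) × ZMod 4 | ∀ i, u ≠ φ (.inl i)} ≃ Fin k × ZMod 4 :=
    { toFun := fun u => (⟨u.1.1.val, (remaining u.1).1 u.2⟩, u.1.2)
      invFun := fun w => ⟨(w.1.castSucc, w.2), (remaining _).2 w.1.isLt⟩
      left_inv := fun _ => rfl
      right_inv := fun _ => rfl }
  refine ⟨levelsEquiv, ?_⟩
  intro u w
  rw [nestedQuadrangles_adj_iff_succ, crResult_adj_iff_of_last hφ hlast]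
  rfl

lemma nonempty_crResult_iso (hk : 2 ≤ k)
    {φ : SimpleGraph.Copy crossedCube (nestedQuadrangles (k + 1))} (hφ : CRFeasible φ) :
    Nonempty (crResult φ ≃g nestedQuadrangles k) := by
  obtain ⟨l, hl | hl, hlevel⟩ := hφ.exists_isEndLevel (by omega)
  · let e := reverseLevels (k + 1)
    have hlast : ∀ i, ((e.toCopy.comp φ) (.inl i)).1 = Fin.last k := fun i => by
      change Fin.rev (φ (.inl i)).1 = Fin.last k
      rw [hlevel i, Fin.rev_eq_iff, Fin.rev_last]
      exact Fin.ext hl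
    obtain ⟨f⟩ := nonempty_crResult_iso_of_last (hφ.iso_comp e) hlast
    exact ⟨(crResultIso φ e).trans f⟩
  · exact nonempty_crResult_iso_of_last hφ fun i =>
      (hlevel i).trans (Fin.ext (Nat.succ_injective hl))

/-- The match of the crossed cube whose inner and outer cycle are the last and the second to last
level. -/
def outerCrossedCube (k : ℕ) : SimpleGraph.Copy crossedCube (nestedQuadrangles (k + 2)) where
  toHom :=
    { toFun := Sum.elim (Fin.last (k + 1), ·) ((Fin.last k).castSucc, ·)
      map_rel' := by
        rintro (i | i) (j | j) h
        · rw [crossedCube_adj_inl_inl] at h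
          simp [nestedQuadrangles_adj, IsEndLevel, h]
        · rw [crossedCube_adj_inl_inr] at h
          simp only [Sum.elim_inl, Sum.elim_inr, nestedQuadrangles_adj, ne_eq, Prod.mk.injEq,
            Fin.ext_iff, Fin.val_castSucc, Fin.val_last]
          grind
        · rw [SimpleGraph.adj_comm, crossedCube_adj_inl_inr] at h
          have : j ≠ i + 2 := by
            decide +revert
          simp only [Sum.elim_inl, Sum.elim_inr, nestedQuadrangles_adj, ne_eq, Prod.mk.injEq,
            Fin.ext_iff, Fin.val_castSucc, Fin.val_last]
          grind
        · rw [crossedCube_adj_inr_inr] at h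
          have : i ≠ j ∧ j ≠ i + 2 := by
            decide +revert
          simp [nestedQuadrangles_adj, this] }
  injective' := by
    rintro (i | i) (j | j) h
    · simpa using h
    · simp [Fin.ext_iff] at h
    · simp [Fin.ext_iff] at h
    · simpa using h

lemma crFeasible_outerCrossedCube (hk : k ≠ 0) : CRFeasible (outerCrossedCube k) := by
  have not_adj : ∀ a : ZMod 4, ¬ (nestedQuadrangles (k + 2)).Adj ((Fin.last k).castSucc, a)
      ((Fin.last k).castSucc, a + 2) := fun a h => by
    simpa [IsEndLevel, hk] using (nestedQuadrangles_adj.1 h).2.2 rfl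
  exact ⟨fun i => (isCandidate_nestedQuadrangles_iff (by omega) _).2 (Or.inr rfl), not_adj 1,
    not_adj 2⟩

lemma crStep_nestedQuadrangles_succ (hm : 2 ≤ m) :
    CRStep ⟨_, nestedQuadrangles (m + 1)⟩ ⟨_, nestedQuadrangles m⟩ := by
  obtain ⟨k, rfl⟩ := Nat.exists_eq_add_of_le' (one_le_two.trans hm)
  have hφ : CRFeasible (outerCrossedCube k) := crFeasible_outerCrossedCube (by omega)
  exact ⟨outerCrossedCube k, hφ, nonempty_crResult_iso hm hφ⟩

lemma reduces_nestedQuadrangles_two (hm : 2 ≤ m) :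
    Reduces ⟨_, nestedQuadrangles m⟩ ⟨_, nestedQuadrangles 2⟩ := by
  induction m, hm using Nat.le_induction with
  | base => exact .refl
  | succ m hm ih => exact .head (.inr (crStep_nestedQuadrangles_succ hm)) ih

lemma not_crFeasible_nestedQuadrangles_two
    (φ : SimpleGraph.Copy crossedCube (nestedQuadrangles 2)) : ¬ CRFeasible φ := by
  refine not_crFeasible_of_forall_isCandidate (card_fin_prod_zmod_four 2) (fun u => ?_) φ
  rw [isCandidate_nestedQuadrangles_iff le_rfl, IsEndLevel]
  omega

variable {A B : BundledGraph}

lemma not_srStep_of_iso (hm : 2 ≤ m) (e : A.graph ≃g nestedQuadrangles m) : ¬ SRStep A B := by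
  rintro ⟨φ, hφ, -⟩
  exact not_srFeasible_nestedQuadrangles hm _ (hφ.iso_comp e)

lemma exists_iso_nestedQuadrangles_of_crStep (hm : 2 ≤ m) (e : A.graph ≃g nestedQuadrangles m)
    (h : CRStep A B) : ∃ k, 2 ≤ k ∧ Nonempty (B.graph ≃g nestedQuadrangles k) := by
  obtain ⟨φ, hφ, ⟨f⟩⟩ : CRStep ⟨_, nestedQuadrangles m⟩ B := h.of_iso e
  rcases hm.eq_or_lt with rfl | hlt
  · exact absurd hφ (not_crFeasible_nestedQuadrangles_two φ)
  · obtain ⟨k, rfl⟩ := Nat.exists_eq_add_of_lt hlt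
    obtain ⟨g⟩ := nonempty_crResult_iso (by omega) hφ
    exact ⟨2 + k, by omega, ⟨f.symm.trans g⟩⟩

lemma exists_iso_nestedQuadrangles_of_reduces (hm : 2 ≤ m)
    (h : Reduces ⟨_, nestedQuadrangles m⟩ A) :
    ∃ k, 2 ≤ k ∧ Nonempty (A.graph ≃g nestedQuadrangles k) := by
  induction h with
  | refl => exact ⟨m, hm, ⟨SimpleGraph.Iso.refl⟩⟩
  | tail _ step ih =>
    obtain ⟨k, hk, ⟨e⟩⟩ := ih
    rcases step with sr | cr
    · exact absurd sr (not_srStep_of_iso hk e)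
    · exact exists_iso_nestedQuadrangles_of_crStep hk e cr

end Reductions

section ExtendedWheel

lemma extendedWheel_three_adj (u w : ZMod (2 * 3) ⊕ Bool) :
    (extendedWheel 3).Adj u w ↔ u ≠ w ∧ w ≠ Sum.map (· + 3) not u := by
  have cycle : ∀ i j : ZMod (2 * 3),
      (i ≠ j ∧ ((j = i + 1 ∨ j = i + 2) ∨ (i = j + 1 ∨ i = j + 2))) ↔ i ≠ j ∧ j ≠ i + 3 := by
    decide
  rw [extendedWheel, SimpleGraph.fromRel_adj]
  rcases u with i | i <;> rcases w with j | j
  · simpa using cycle i j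
  · simp
  · simp
  · cases i <;> cases j <;> simp

/-- The isomorphism from the nested crossed quadrangles with two levels to `XW_6`. Both are the
complement of a perfect matching on eight vertices, and the matched pairs correspond. -/
def nestedQuadranglesTwoIso : nestedQuadrangles 2 ≃g extendedWheel 3 where
  toFun := fun u => match u with
    | (0, 0) => .inl 0
    | (0, 1) => .inl 1
    | (0, 2) => .inl 2
    | (0, 3) => .inr false
    | (1, 0) => .inl 5
    | (1, 1) => .inr true
    | (1, 2) => .inl 3
    | (1, 3) => .inl 4
  invFun := fun u => match u with
    | .inl 0 => (0, 0)
    | .inl 1 => (0, 1)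
    | .inl 2 => (0, 2)
    | .inl 3 => (1, 2)
    | .inl 4 => (1, 3)
    | .inl 5 => (1, 0)
    | .inr false => (0, 3)
    | .inr true => (1, 1)
  left_inv := by decide
  right_inv := by decide
  map_rel_iff' := by
    intro u w
    rw [nestedQuadrangles_adj, extendedWheel_three_adj]
    unfold IsEndLevel
    decide +revert

lemma ncard_neighborSet_nestedQuadrangles_le {m : ℕ} (hm : 2 ≤ m) (u : Fin m × ZMod 4) :
    ((nestedQuadrangles m).neighborSet u).ncard ≤ 8 := by
  obtain ⟨i, a⟩ := u
  by_cases hi : IsEndLevel i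
  · rw [ncard_neighborSet_of_isEndLevel hm hi]
    norm_num
  · rw [ncard_neighborSet_of_not_isEndLevel hi]

lemma ncard_neighborSet_extendedWheel_inr (k : ℕ) (b : Bool) :
    ((extendedWheel k).neighborSet (.inr b)).ncard = 2 * k := by
  have eq_range : (extendedWheel k).neighborSet (.inr b) = Set.range Sum.inl := by
    ext (i | i) <;> simp [extendedWheel]
  rw [eq_range, Set.ncard_range_of_injective Sum.inl_injective, Nat.card_zmod]

lemma eq_three_of_iso_extendedWheel {m k : ℕ} (hm : 2 ≤ m)
    (e : nestedQuadrangles m ≃g extendedWheel k) : k = 3 := by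
  have card_eq : 4 * m = 2 * k + 2 := by
    have : Finite (ZMod (2 * k) ⊕ Bool) := Finite.of_equiv _ e.toEquiv
    have : Finite (ZMod (2 * k)) := Finite.sum_left Bool
    rw [← card_fin_prod_zmod_four, Nat.card_congr e.toEquiv, Nat.card_sum, Nat.card_zmod,
      Nat.card_eq_fintype_card, Fintype.card_bool]
  have degree_le : 2 * k ≤ 8 := by
    obtain ⟨u, hu⟩ := e.surjective (.inr true)
    rw [← ncard_neighborSet_extendedWheel_inr k true, ← hu, ncard_neighborSet_iso_apply]
    exact ncard_neighborSet_nestedQuadrangles_le hm u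
  omega

end ExtendedWheel

theorem mainTheorem7 :
    (∀ m : ℕ, 3 ≤ m →
      IsOptimalOnePlanar (nestedQuadrangles m) ∧
      (∃ H : BundledGraph, Reduces ⟨_, nestedQuadrangles m⟩ H ∧
        Nonempty (H.graph ≃g extendedWheel 3)) ∧
      (∀ k : ℕ, 3 ≤ k → ∀ H : BundledGraph, Reduces ⟨_, nestedQuadrangles m⟩ H →
        Nonempty (H.graph ≃g extendedWheel k) → k = 3) ∧
      (∀ H : BundledGraph, Reduces ⟨_, nestedQuadrangles m⟩ H →
        IsOptimalOnePlanar H.graph ∧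
        (∀ H' : BundledGraph, ¬ SRStep H H') ∧
        (Nonempty (H.graph ≃g extendedWheel 3) ∨ ∃ H' : BundledGraph, CRStep H H'))) ∧
    (∀ m m' : ℕ, 3 ≤ m → 3 ≤ m' →
      Nonempty (nestedQuadrangles m ≃g nestedQuadrangles m') → m = m') := by
  refine ⟨fun m hm => ?_, fun m m' _ _ ⟨e⟩ => ?_⟩
  · have two_le : 2 ≤ m := by omega
    refine ⟨isOptimalOnePlanar_nestedQuadrangles two_le,
      ⟨_, reduces_nestedQuadrangles_two two_le, ⟨nestedQuadranglesTwoIso⟩⟩,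
      fun k _ H hH ⟨f⟩ => ?_, fun H hH => ?_⟩ <;>
      obtain ⟨j, hj, ⟨e⟩⟩ := exists_iso_nestedQuadrangles_of_reduces two_le hH
    · exact eq_three_of_iso_extendedWheel hj (e.symm.trans f)
    · refine ⟨(isOptimalOnePlanar_nestedQuadrangles hj).of_iso e,
        fun _ => not_srStep_of_iso hj e, ?_⟩
      rcases hj.eq_or_lt with rfl | hlt
      · exact .inl ⟨e.trans nestedQuadranglesTwoIso⟩
      · obtain ⟨n, rfl⟩ := Nat.exists_eq_add_of_le' (one_le_two.trans hj)
        exact .inr ⟨_, (crStep_nestedQuadrangles_succ (by omega)).of_iso e.symm⟩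
  · have card_eq := Nat.card_congr e.toEquiv
    rw [card_fin_prod_zmod_four, card_fin_prod_zmod_four] at card_eq
    omega
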